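/- Let $n\in\mathbb N$ and let $k$ be a field. An $n$-parameter persistence module is a functor $M$ from the poset $\mathbb{R}^n$ (coordinatewise order) to $k$-vector spaces. For $\delta\ge 0$ write $\vec\delta=(\delta,\dots,\delta)$; a $\delta$-interleaving of $M$ and $N$ consists of families of linear maps $M(x)\to N(x+\vec\delta)$ and $N(x)\to M(x+\vec\delta)$, $x\in\mathbb R^n$, commuting with the structure maps and whose two composites are the structure maps $M(x)\to M(x+2\vec\delta)$ and $N(x)\to N(x+2\vec\delta)$. The interleaving distance $d_I(M,N)\in[0,\infty]$ is the infimum of all $\delta\ge0$ for which a $\delta$-interleaving exists ($\infty$ if there is none). Let $\overline{\mathbb R}=\mathbb R\cup\{\pm\infty\}$. An interval is a nonempty order-convex set $I\subseteq\overline{\mathbb R}^n$ any two points of which are joined by a finite zigzag of comparable points of $I$; a persistence module $M$ is an interval module with interval $I_M$ if, up to isomorphism, $M(x)=k$ for $x\in I_M$, $M(x)=0$ for $x\notin I_M$, and $M(x\le y)$ is the identity whenever $x,y\in I_M$. A rectangle is a set $[u,v]=\{w: u\le w\le v\}$ with $u\le v$ in $\overline{\mathbb R}^n$, and a rectangle module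 is an interval module whose interval is a rectangle. The bounding rectangle of $I$ is the smallest rectangle containing $I$. Let $M$ be an interval module with interval $I_M$, and let $B$ be the bounding rectangle of $I_M$. Then for every rectangle module $R$ with rectangle $I_R\not\subseteq B$ there is a rectangle module $R'$ with rectangle $I_{R'}\subseteq B$ and $$d_I(M,R')\le d_I(M,R).$$ Consequently, the infimum of $d_I(M,R)$ over all rectangle modules $R$ equals the infimum over those with $I_R\subseteq B$, and if some rectangle module attains this infimum, then so does one with rectangle contained in $B$. -/

import Mathlib

open CategoryTheory
open scoped NNReal ENNReal

universe u

/-- The poset `ℝⁿ` with the coordinatewise order. (A type of its own, so that its categorical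
structure is the one of a poset.) -/
def RSpace (n : ℕ) : Type := Fin n → ℝ

instance (n : ℕ) : PartialOrder (RSpace n) := inferInstanceAs (PartialOrder (Fin n → ℝ))

/-- An `n`-parameter persistence module over the field `k`: a functor from the poset `ℝⁿ`
to `k`-vector spaces. -/
abbrev PersMod (n : ℕ) (k : Type u) [Field k] : Type (u + 1) :=
  RSpace n ⥤ ModuleCat.{u} k

/-- The diagonal translate `x + (δ, …, δ)`. -/
def diagShift {n : ℕ} (δ : ℝ≥0) (x : RSpace n) : RSpace n := fun i => x i + (δ : ℝ)

theorem le_diagShift {n : ℕ} (δ : ℝ≥0) (x : RSpace n) : x ≤ diagShift δ x :=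
  fun i => le_add_of_nonneg_right (a := x i) δ.coe_nonneg

theorem diagShift_mono {n : ℕ} (δ : ℝ≥0) {x y : RSpace n} (h : x ≤ y) :
    diagShift δ x ≤ diagShift δ y :=
  fun i => add_le_add_left (h i) (δ : ℝ)

/-- A `δ`-interleaving between `M` and `N`: two families of linear maps
`φ x : M x → N (x + δ)` and `ψ x : N x → M (x + δ)`, commuting with the structure maps and
composing to the structure maps `x → x + 2δ` (written as `x + δ + δ`). -/
structure Interleaving {n : ℕ} {k : Type u} [Field k] (δ : ℝ≥0) (M N : PersMod n k) where
  φ : ∀ x : RSpace n, M.obj x ⟶ N.obj (diagShift δ x)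
  ψ : ∀ x : RSpace n, N.obj x ⟶ M.obj (diagShift δ x)
  φ_natural : ∀ (x y : RSpace n) (h : x ≤ y),
    M.map (homOfLE h) ≫ φ y = φ x ≫ N.map (homOfLE (diagShift_mono δ h))
  ψ_natural : ∀ (x y : RSpace n) (h : x ≤ y),
    N.map (homOfLE h) ≫ ψ y = ψ x ≫ M.map (homOfLE (diagShift_mono δ h))
  φ_comp_ψ : ∀ x : RSpace n, φ x ≫ ψ (diagShift δ x) =
    M.map (homOfLE ((le_diagShift δ x).trans (le_diagShift δ (diagShift δ x))))
  ψ_comp_φ : ∀ x : RSpace n, ψ x ≫ φ (diagShift δ x) =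
    N.map (homOfLE ((le_diagShift δ x).trans (le_diagShift δ (diagShift δ x))))

/-- The interleaving distance, with value `∞` if there is no interleaving at all. -/
noncomputable def interleavingDist {n : ℕ} {k : Type u} [Field k] (M N : PersMod n k) : ℝ≥0∞ :=
  ⨅ (δ : ℝ≥0) (_ : Nonempty (Interleaving δ M N)), (δ : ℝ≥0∞)

/-- An interval of the extended poset `[-∞, ∞]ⁿ`: a nonempty, order-convex set, any two points of
which are joined by a finite zigzag of comparable points of the set. -/
structure IsInterval {n : ℕ} (I : Set (Fin n → EReal)) : Prop where
  nonempty : I.Nonempty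
  convex : ∀ p ∈ I, ∀ q ∈ I, ∀ r, p ≤ r → r ≤ q → r ∈ I
  connected : ∀ p ∈ I, ∀ q ∈ I,
    Relation.ReflTransGen (fun a b => a ∈ I ∧ b ∈ I ∧ (a ≤ b ∨ b ≤ a)) p q

/-- The inclusion of `ℝⁿ` into `[-∞, ∞]ⁿ`. -/
def toExt {n : ℕ} (x : RSpace n) : Fin n → EReal := fun i => (x i : EReal)

theorem toExt_mono {n : ℕ} {x y : RSpace n} (h : x ≤ y) : toExt x ≤ toExt y :=
  fun i => EReal.coe_le_coe_iff.2 (h i)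

open Classical in
/-- The interval module of `I`. Its value at `x` is the space of functions to `k` from a one-point
type if `x ∈ I` (a copy of `k`) and from an empty type if `x ∉ I` (zero); its structure map from `x`
to `y` is the identity of `k` if `x, y ∈ I`, and zero otherwise. -/
noncomputable def intervalModule {n : ℕ} (k : Type u) [Field k] (I : Set (Fin n → EReal))
    (hI : IsInterval I) : PersMod n k where
  obj x := ModuleCat.of k (PLift (toExt x ∈ I) → k)
  map {x _} _ := ModuleCat.ofHom
    { toFun := fun f _ => if hx : toExt x ∈ I then f ⟨hx⟩ else 0
      map_add' := fun f g => by
        funext _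
        by_cases hx : toExt x ∈ I <;> simp [hx]
      map_smul' := fun c f => by
        funext _
        by_cases hx : toExt x ∈ I <;> simp [hx] }
  map_id x := by
    refine ModuleCat.hom_ext (LinearMap.ext fun f => funext fun hx => ?_)
    simp [hx.down]
  map_comp {x y z} f g := by
    refine ModuleCat.hom_ext (LinearMap.ext fun v => funext fun hz => ?_)
    by_cases hx : toExt x ∈ I
    · have hy : toExt y ∈ I :=
        hI.convex _ hx _ hz.down _ (toExt_mono (leOfHom f)) (toExt_mono (leOfHom g))
      simp [hx, hy]
    · simp [hx]

/-- `M` is an interval module with underlying interval `I`. -/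
def IsIntervalModule {n : ℕ} {k : Type u} [Field k] (M : PersMod n k)
    (I : Set (Fin n → EReal)) : Prop :=
  ∃ hI : IsInterval I, Nonempty (M ≅ intervalModule k I hI)

/-- A rectangle `[u, v]` of `[-∞, ∞]ⁿ`, where `u ≤ v`. -/
def IsRectangle {n : ℕ} (J : Set (Fin n → EReal)) : Prop :=
  ∃ u v : Fin n → EReal, u ≤ v ∧ J = Set.Icc u v

/-- `R` is a rectangle module with underlying rectangle `J`. -/
def IsRectangleModule {n : ℕ} {k : Type u} [Field k] (R : PersMod n k)
    (J : Set (Fin n → EReal)) : Prop :=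
  IsRectangle J ∧ IsIntervalModule R J

/-- `B` is the bounding rectangle of `I`: the smallest rectangle that contains `I`. -/
def IsBoundingRectangle {n : ℕ} (B I : Set (Fin n → EReal)) : Prop :=
  IsLeast {J : Set (Fin n → EReal) | IsRectangle J ∧ I ⊆ J} B

/-- The bounding rectangle of a nonempty set exists. -/
theorem isBoundingRectangle_Icc {n : ℕ} {I : Set (Fin n → EReal)} (hI : I.Nonempty) :
    IsBoundingRectangle (Set.Icc (sInf I) (sSup I)) I := by
  refine ⟨⟨⟨_, _, sInf_le_sSup hI, rfl⟩, fun x hx => ⟨sInf_le hx, le_sSup hx⟩⟩, ?_⟩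
  rintro _ ⟨⟨u, v, -, rfl⟩, h⟩
  exact Set.Icc_subset_Icc (le_sInf fun x hx => (h hx).1) (sSup_le fun x hx => (h hx).2)

/-- All rectangle modules. -/
def rectangleModules (n : ℕ) (k : Type u) [Field k] : Set (PersMod n k) :=
  {R | ∃ J, IsRectangleModule R J}

/-- The rectangle modules whose rectangle lies in `B`. -/
def rectangleModulesIn {n : ℕ} (k : Type u) [Field k] (B : Set (Fin n → EReal)) :
    Set (PersMod n k) :=
  {R | ∃ J, IsRectangleModule R J ∧ J ⊆ B}

/-- The interleaving distance from `M` to a class of persistence modules. -/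
noncomputable def distToClass {n : ℕ} {k : Type u} [Field k] (M : PersMod n k)
    (𝒩 : Set (PersMod n k)) : ℝ≥0∞ :=
  ⨅ N ∈ 𝒩, interleavingDist M N

/-- `N` is an optimal approximation of `M` from the class `𝒩`, for the interleaving distance. -/
def IsOptimalApprox {n : ℕ} {k : Type u} [Field k] (M : PersMod n k) (𝒩 : Set (PersMod n k))
    (N : PersMod n k) : Prop :=
  N ∈ 𝒩 ∧ interleavingDist M N = distToClass M 𝒩

/-! Replace the rectangle `J` of `R` by `J ∩ B`, which is again a rectangle if nonempty. Restriction
and extension by zero between the two modules are in general not morphisms on all of `ℝⁿ`, but they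
commute with structure maps inside `B`. This suffices: `M` and the new module vanish off `B`, so an
interleaving identity is nontrivial only if its two ends lie in `B`, and by convexity so does
everything between (`Interleaving.inter`).

If `J ∩ B` is empty, every map `M x → M (x + 2δ)` factors through zero. Then zero maps interleave
`M` with a one-point module in `B` at every scale above `δ`, and the infimum absorbs the excess. -/

theorem isInterval_Icc {n : ℕ} {u v : Fin n → EReal} (h : u ≤ v) : IsInterval (Set.Icc u v) where
  nonempty := ⟨u, le_rfl, h⟩
  convex _ hp _ hq _ hpr hrq := ⟨hp.1.trans hpr, hrq.trans hq.2⟩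
  connected _ hp _ hq :=
    -- The zigzag passes through the least corner `u`.
    (Relation.ReflTransGen.single ⟨hp, ⟨le_rfl, h⟩, Or.inr hp.1⟩).tail
      ⟨⟨le_rfl, h⟩, hq, Or.inl hq.1⟩

theorem IsRectangle.isInterval {n : ℕ} {J : Set (Fin n → EReal)} (hJ : IsRectangle J) :
    IsInterval J := by
  obtain ⟨u, v, h, rfl⟩ := hJ
  exact isInterval_Icc h

theorem IsRectangle.inter {n : ℕ} {J B : Set (Fin n → EReal)} (hJ : IsRectangle J)
    (hB : IsRectangle B) (h : (J ∩ B).Nonempty) : IsRectangle (J ∩ B) := by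
  obtain ⟨u, v, -, rfl⟩ := hJ
  obtain ⟨a, b, -, rfl⟩ := hB
  obtain ⟨x, hx⟩ := h
  rw [Set.Icc_inter_Icc] at hx ⊢
  exact ⟨_, _, hx.1.trans hx.2, rfl⟩

theorem isRectangle_singleton {n : ℕ} (p : Fin n → EReal) : IsRectangle {p} :=
  ⟨p, p, le_rfl, (Set.Icc_self p).symm⟩

theorem isRectangleModule_intervalModule {n : ℕ} (k : Type u) [Field k]
    {J : Set (Fin n → EReal)} (hJ : IsRectangle J) :
    IsRectangleModule (intervalModule k J hJ.isInterval) J :=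
  ⟨hJ, hJ.isInterval, ⟨Iso.refl _⟩⟩

theorem isZero_intervalModule_obj {n : ℕ} {k : Type u} [Field k] {I : Set (Fin n → EReal)}
    (hI : IsInterval I) {x : RSpace n} (hx : toExt x ∉ I) :
    Limits.IsZero ((intervalModule k I hI).obj x) := by
  have : IsEmpty (PLift (toExt x ∈ I)) := ⟨fun h => hx h.down⟩
  have : Subsingleton ((intervalModule k I hI).obj x) :=
    inferInstanceAs (Subsingleton (PLift (toExt x ∈ I) → k))
  exact ModuleCat.isZero_of_subsingleton _

theorem IsIntervalModule.isZero_obj {n : ℕ} {k : Type u} [Field k] {M : PersMod n k}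
    {I : Set (Fin n → EReal)} (hM : IsIntervalModule M I) {x : RSpace n} (hx : toExt x ∉ I) :
    Limits.IsZero (M.obj x) := by
  obtain ⟨hI, ⟨e⟩⟩ := hM
  exact (isZero_intervalModule_obj hI hx).of_iso (e.app x)

/-- Interleavings are transported along isomorphisms. -/
def Interleaving.congrRight {n : ℕ} {k : Type u} [Field k] {δ : ℝ≥0} {M N N' : PersMod n k}
    (s : Interleaving δ M N) (e : N ≅ N') : Interleaving δ M N' where
  φ x := s.φ x ≫ e.hom.app _
  ψ x := e.inv.app _ ≫ s.ψ x
  φ_natural x y h := by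
    rw [← Category.assoc, s.φ_natural, Category.assoc, Category.assoc, e.hom.naturality]
  ψ_natural x y h := by
    rw [← Category.assoc, e.inv.naturality, Category.assoc, Category.assoc, s.ψ_natural]
  φ_comp_ψ x := by simp [s.φ_comp_ψ]
  ψ_comp_φ x := by
    have h := s.ψ_comp_φ x
    rw [Category.assoc, ← Category.assoc (s.ψ x), h, e.hom.naturality, ← Category.assoc]
    simp

/-- The restriction from the interval module of `J` to that of a smaller interval `J ∩ B`. -/
noncomputable def interRestrict {n : ℕ} (k : Type u) [Field k] {J B : Set (Fin n → EReal)}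
    (hJ : IsInterval J) (hJB : IsInterval (J ∩ B)) (x : RSpace n) :
    (intervalModule k J hJ).obj x ⟶ (intervalModule k (J ∩ B) hJB).obj x :=
  ModuleCat.ofHom
    (LinearMap.funLeft k k fun h : PLift (toExt x ∈ J ∩ B) => PLift.up h.down.1)

open Classical in
/-- The extension by zero from the interval module of `J ∩ B` to that of `J`. -/
noncomputable def interExtend {n : ℕ} (k : Type u) [Field k] {J B : Set (Fin n → EReal)}
    (hJ : IsInterval J) (hJB : IsInterval (J ∩ B)) (x : RSpace n) :
    (intervalModule k (J ∩ B) hJB).obj x ⟶ (intervalModule k J hJ).obj x :=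
  ModuleCat.ofHom
    { toFun := fun (f : PLift (toExt x ∈ J ∩ B) → k) (h : PLift (toExt x ∈ J)) =>
        if hB : toExt x ∈ B then f ⟨h.down, hB⟩ else 0
      map_add' := fun f g => by
        funext _
        by_cases hB : toExt x ∈ B <;> simp [hB]
      map_smul' := fun c f => by
        funext _
        by_cases hB : toExt x ∈ B <;> simp [hB] }

section

variable {n : ℕ} {k : Type u} [Field k] {J B : Set (Fin n → EReal)} (hJ : IsInterval J)
  (hJB : IsInterval (J ∩ B))

theorem interExtend_comp_interRestrict (x : RSpace n) :
    interExtend k hJ hJB x ≫ interRestrict k hJ hJB x = 𝟙 _ := by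
  refine ModuleCat.hom_ext (LinearMap.ext fun f => funext fun h => ?_)
  exact dif_pos h.down.2

theorem interRestrict_comp_interExtend {x : RSpace n} (hx : toExt x ∈ B) :
    interRestrict k hJ hJB x ≫ interExtend k hJ hJB x = 𝟙 _ := by
  refine ModuleCat.hom_ext (LinearMap.ext fun f => funext fun h => ?_)
  exact dif_pos hx

/-- Without `toExt x ∈ B` this fails for `x ∈ J \ B` and `y ∈ J ∩ B`: the left side is the identity
of `k`, the right side zero. -/
theorem interRestrict_natural {x y : RSpace n} (h : x ≤ y) (hx : toExt x ∈ B) :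
    (intervalModule k J hJ).map (homOfLE h) ≫ interRestrict k hJ hJB y =
      interRestrict k hJ hJB x ≫ (intervalModule k (J ∩ B) hJB).map (homOfLE h) := by
  refine ModuleCat.hom_ext (LinearMap.ext fun f => funext fun hy => ?_)
  by_cases hxJ : toExt x ∈ J
  · refine (dif_pos hxJ).trans (Eq.symm ?_)
    exact dif_pos (c := toExt x ∈ J ∩ B) ⟨hxJ, hx⟩
  · refine (dif_neg hxJ).trans (Eq.symm ?_)
    exact dif_neg (c := toExt x ∈ J ∩ B) fun hh => hxJ hh.1

/-- Over `B` extension is inverse to restriction, so its naturality follows. It fails for `x ∈ J ∩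
B` and `y ∈ J \ B`. -/
theorem interExtend_natural {x y : RSpace n} (h : x ≤ y) (hx : toExt x ∈ B) (hy : toExt y ∈ B) :
    (intervalModule k (J ∩ B) hJB).map (homOfLE h) ≫ interExtend k hJ hJB y =
      interExtend k hJ hJB x ≫ (intervalModule k J hJ).map (homOfLE h) := by
  rw [← Category.id_comp ((intervalModule k (J ∩ B) hJB).map _),
    ← interExtend_comp_interRestrict hJ hJB x, Category.assoc, Category.assoc,
    ← Category.assoc (interRestrict k hJ hJB x), ← interRestrict_natural hJ hJB h hx,
    Category.assoc, interRestrict_comp_interExtend hJ hJB hy, Category.comp_id]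

/-- If `M` is supported in an order-convex set `B`, an interleaving of `M` with the interval module
of `J` restricts to one with the interval module of `J ∩ B`. -/
noncomputable def Interleaving.inter {δ : ℝ≥0} {M : PersMod n k} (hB : B.OrdConnected)
    (hM : ∀ x : RSpace n, toExt x ∉ B → Limits.IsZero (M.obj x))
    (s : Interleaving δ M (intervalModule k J hJ)) :
    Interleaving δ M (intervalModule k (J ∩ B) hJB) where
  φ x := s.φ x ≫ interRestrict k hJ hJB _
  ψ x := interExtend k hJ hJB x ≫ s.ψ x
  φ_natural x y h := by
    by_cases hx : toExt x ∈ B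
    · by_cases hy : toExt (diagShift δ y) ∈ B
      -- The intermediate point lies between `x` and `diagShift δ y`, both in `B`.
      · have hx' : toExt (diagShift δ x) ∈ B := hB.out hx hy
          ⟨toExt_mono (le_diagShift δ x), toExt_mono (diagShift_mono δ h)⟩
        rw [← Category.assoc, s.φ_natural, Category.assoc, interRestrict_natural hJ hJB _ hx',
          Category.assoc]
      · exact (isZero_intervalModule_obj hJB fun hh => hy hh.2).eq_of_tgt _ _
    · exact (hM x hx).eq_of_src _ _
  ψ_natural x y h := by
    by_cases hx : toExt x ∈ B
    · by_cases hy : toExt (diagShift δ y) ∈ B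
      · have hy' : toExt y ∈ B := hB.out hx hy ⟨toExt_mono h, toExt_mono (le_diagShift δ y)⟩
        rw [← Category.assoc, interExtend_natural hJ hJB _ hx hy', Category.assoc, s.ψ_natural,
          Category.assoc]
      · exact (hM _ hy).eq_of_tgt _ _
    · exact (isZero_intervalModule_obj hJB fun hh => hx hh.2).eq_of_src _ _
  φ_comp_ψ x := by
    by_cases hx : toExt x ∈ B
    · by_cases hy : toExt (diagShift δ (diagShift δ x)) ∈ B
      · have hx' : toExt (diagShift δ x) ∈ B := hB.out hx hy
          ⟨toExt_mono (le_diagShift δ x), toExt_mono (le_diagShift δ _)⟩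
        rw [Category.assoc, ← Category.assoc (interRestrict k hJ hJB _),
          interRestrict_comp_interExtend hJ hJB hx', Category.id_comp, s.φ_comp_ψ]
      · exact (hM _ hy).eq_of_tgt _ _
    · exact (hM x hx).eq_of_src _ _
  ψ_comp_φ x := by
    by_cases hx : toExt x ∈ B
    -- The target needs no case split: restriction is natural as soon as the source lies in `B`.
    · rw [Category.assoc, ← Category.assoc (s.ψ x), s.ψ_comp_φ,
        interRestrict_natural hJ hJB _ hx, ← Category.assoc, interExtend_comp_interRestrict,
        Category.id_comp]
    · exact (isZero_intervalModule_obj hJB fun hh => hx hh.2).eq_of_src _ _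

end

/-- If `M` is supported in an order-convex set on which `N` vanishes, then a `δ`-interleaving of `M`
and `N` forces the structure maps `x → x + 2δ` of `M` to vanish. -/
theorem Interleaving.map_eq_zero {n : ℕ} {k : Type u} [Field k] {δ : ℝ≥0} {M N : PersMod n k}
    {B : Set (Fin n → EReal)} (hB : B.OrdConnected)
    (hM : ∀ x : RSpace n, toExt x ∉ B → Limits.IsZero (M.obj x))
    (hN : ∀ x : RSpace n, toExt x ∈ B → Limits.IsZero (N.obj x))
    (s : Interleaving δ M N) (x : RSpace n) :
    M.map (homOfLE ((le_diagShift δ x).trans (le_diagShift δ (diagShift δ x)))) = 0 := by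
  by_cases hx : toExt x ∈ B
  · by_cases hy : toExt (diagShift δ (diagShift δ x)) ∈ B
    · rw [← s.φ_comp_ψ, (hN _ (hB.out hx hy ⟨toExt_mono (le_diagShift δ x),
        toExt_mono (le_diagShift δ _)⟩)).eq_of_tgt (s.φ x) 0, Limits.zero_comp]
    · exact (hM _ hy).eq_of_tgt _ _
  · exact (hM x hx).eq_of_src _ _

/-- The zero maps interleave modules whose structure maps `x → x + 2δ` vanish. -/
noncomputable def Interleaving.ofMapEqZero {n : ℕ} {k : Type u} [Field k] {δ : ℝ≥0}
    {M N : PersMod n k}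
    (hM : ∀ x, M.map (homOfLE ((le_diagShift δ x).trans (le_diagShift δ (diagShift δ x)))) = 0)
    (hN : ∀ x, N.map (homOfLE ((le_diagShift δ x).trans (le_diagShift δ (diagShift δ x)))) = 0) :
    Interleaving δ M N where
  φ _ := 0
  ψ _ := 0
  φ_natural _ _ _ := by simp
  ψ_natural _ _ _ := by simp
  φ_comp_ψ x := by rw [hM]; simp
  ψ_comp_φ x := by rw [hN]; simp

/-- The longer structure map factors through the shorter one. -/
theorem map_eq_zero_of_le {n : ℕ} {k : Type u} [Field k] {M : PersMod n k} {δ ε : ℝ≥0}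
    (hδε : δ ≤ ε)
    (hM : ∀ x, M.map (homOfLE ((le_diagShift δ x).trans (le_diagShift δ (diagShift δ x)))) = 0)
    (x : RSpace n) :
    M.map (homOfLE ((le_diagShift ε x).trans (le_diagShift ε (diagShift ε x)))) = 0 := by
  have h : diagShift δ (diagShift δ x) ≤ diagShift ε (diagShift ε x) := fun i =>
    add_le_add (add_le_add_right (NNReal.coe_le_coe.2 hδε) _) (NNReal.coe_le_coe.2 hδε)
  rw [← homOfLE_comp ((le_diagShift δ x).trans (le_diagShift δ (diagShift δ x))) h, M.map_comp,
    hM, Limits.zero_comp]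

theorem intervalModule_singleton_map_eq_zero {n : ℕ} [NeZero n] {k : Type u} [Field k]
    {p : Fin n → EReal} (hp : IsInterval {p}) {δ : ℝ≥0} (hδ : 0 < δ) (x : RSpace n) :
    (intervalModule k {p} hp).map
      (homOfLE ((le_diagShift δ x).trans (le_diagShift δ (diagShift δ x)))) = 0 := by
  by_cases hx : toExt x ∈ ({p} : Set (Fin n → EReal))
  · refine (isZero_intervalModule_obj hp fun hy => ?_).eq_of_tgt _ _
    -- `x` and its translate would both be `p`; coordinate `0` exists because `n ≠ 0`.
    have h := congrFun (hy.trans hx.symm) 0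
    have h' : x 0 + (δ : ℝ) + (δ : ℝ) = x 0 := EReal.coe_injective h
    have : (0 : ℝ) < δ := hδ
    linarith
  · exact (isZero_intervalModule_obj hp hx).eq_of_src _ _

theorem interleavingDist_le {n : ℕ} {k : Type u} [Field k] {M N : PersMod n k} {δ : ℝ≥0}
    (s : Interleaving δ M N) : interleavingDist M N ≤ δ :=
  iInf₂_le δ ⟨s⟩

/-- A module supported in a rectangle `B` is at least as close to some rectangle module in `B` as
to a given rectangle module. -/
theorem exists_rectangleModule_subset_interleavingDist_le {n : ℕ} {k : Type u} [Field k]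
    {M R : PersMod n k} {B J : Set (Fin n → EReal)} (hB : IsRectangle B)
    (hM : ∀ x : RSpace n, toExt x ∉ B → Limits.IsZero (M.obj x)) (hR : IsRectangleModule R J) :
    ∃ (R' : PersMod n k) (J' : Set (Fin n → EReal)), IsRectangleModule R' J' ∧ J' ⊆ B ∧
      interleavingDist M R' ≤ interleavingDist M R := by
  have hBc : B.OrdConnected := by
    obtain ⟨a, b, -, rfl⟩ := hB
    exact Set.ordConnected_Icc
  obtain ⟨hJ, hRJ⟩ := hR
  rcases (J ∩ B).eq_empty_or_nonempty with hne | hne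
  · obtain ⟨p, hp⟩ := hB.isInterval.nonempty
    -- For `n = 0` the ambient poset is a single point, so the nonempty sets `J` and `B` would meet.
    have : NeZero n := ⟨by
      rintro rfl
      obtain ⟨q, hq⟩ := hJ.isInterval.nonempty
      exact Set.eq_empty_iff_forall_notMem.1 hne p ⟨Subsingleton.elim q p ▸ hq, hp⟩⟩
    refine ⟨_, {p}, isRectangleModule_intervalModule k (isRectangle_singleton p),
      Set.singleton_subset_iff.2 hp, le_iInf₂ fun δ ⟨s⟩ => ?_⟩
    have hM0 := s.map_eq_zero hBc hM fun x hx =>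
      hRJ.isZero_obj fun hxJ => Set.eq_empty_iff_forall_notMem.1 hne _ ⟨hxJ, hx⟩
    -- The slack `ε` covers `δ = 0`, where the structure maps of a one-point module need not vanish.
    refine ENNReal.le_of_forall_pos_le_add fun ε hε _ => ?_
    rw [← ENNReal.coe_add]
    exact interleavingDist_le (Interleaving.ofMapEqZero
      (map_eq_zero_of_le (le_add_of_nonneg_right hε.le) hM0)
      (intervalModule_singleton_map_eq_zero _ (add_pos_of_nonneg_of_pos δ.2 hε)))
  · have hJB := hJ.inter hB hne
    obtain ⟨hJi, ⟨e⟩⟩ := hRJ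
    exact ⟨_, J ∩ B, isRectangleModule_intervalModule k hJB, Set.inter_subset_right,
      le_iInf₂ fun δ ⟨s⟩ => interleavingDist_le ((s.congrRight e).inter hJi hJB.isInterval hBc hM)⟩

theorem propositionA {n : ℕ} {k : Type u} [Field k] (M : PersMod n k)
    (I B : Set (Fin n → EReal)) (hM : IsIntervalModule M I) (hB : IsBoundingRectangle B I) :
    (∀ (R : PersMod n k) (J : Set (Fin n → EReal)), IsRectangleModule R J → ¬ J ⊆ B →
      ∃ (R' : PersMod n k) (J' : Set (Fin n → EReal)), IsRectangleModule R' J' ∧ J' ⊆ B ∧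
        interleavingDist M R' ≤ interleavingDist M R) ∧
    distToClass M (rectangleModulesIn k B) = distToClass M (rectangleModules n k) ∧
    (∀ R : PersMod n k, IsOptimalApprox M (rectangleModules n k) R →
      ∃ R' ∈ rectangleModulesIn k B, IsOptimalApprox M (rectangleModules n k) R') := by
  -- Stated without `¬ J ⊆ B`, so that it also serves the infimum over all rectangle modules.
  have key := fun (R : PersMod n k) (J : Set (Fin n → EReal)) (hR : IsRectangleModule R J) =>
    exists_rectangleModule_subset_interleavingDist_le hB.1.1
      (fun x hx => hM.isZero_obj fun hxI => hx (hB.1.2 hxI)) hR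
  refine ⟨fun R J hR _ => key R J hR, le_antisymm ?_ ?_, ?_⟩
  · refine le_iInf₂ fun R ⟨J, hR⟩ => ?_
    obtain ⟨R', J', hR', hJ', hle⟩ := key R J hR
    exact (iInf₂_le R' ⟨J', hR', hJ'⟩).trans hle
  · exact biInf_mono fun R ⟨J, hR, _⟩ => ⟨J, hR⟩
  · rintro R ⟨⟨J, hR⟩, hopt⟩
    obtain ⟨R', J', hR', hJ', hle⟩ := key R J hR
    exact ⟨R', ⟨J', hR', hJ'⟩, ⟨J', hR'⟩, le_antisymm (hle.trans hopt.le) (iInf₂_le R' ⟨J', hR'⟩)⟩
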